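/- A *non-probabilistic simulation model* is a deterministic Turing machine with a single read-write tape whose squares are indexed by $\mathbb{N}$ and hold bits; it is run from the empty (all-zero) tape. A *probabilistic simulation model* is such a machine that in addition has read access to a random bit tape $\mathbf r\in\{0,1\}^{\infty}$. An intervention $\alpha$ fixes finitely many memory squares to given bits; the machine intervened upon by $\alpha$ first writes these bits to these squares and then runs the original machine, ignoring all writes to the fixed squares. Formulas of the *basic language* are the Boolean combinations (by $\neg,\wedge,\vee$) of conditionals $\langle\alpha\rangle\beta$, where $\alpha$ is an intervention, written as a possibly empty conjunction of literals $X_i$ or $\neg X_i$ with strictly increasing indices, and $\beta$ is a propositional formula over atoms $X_i$ that represent the bits of the memory squares. A non-probabilistic model $\mathsf T$ satisfies $\langle\alpha\rangle\beta$ if $\mathsf T$ intervened upon by $\alpha$ halts with a tape whose assignment satisfies $\beta$; a probabilistic model $\mathsf T$ with random bit tape fixed to $\mathbf r$ satisfies $\langle\alpha\rangle\beta$ (written $\mathsf T,\mathbf r\models\langle\alpha\rangle\beta$) if $\mathsf T$ intervened upon by $\alpha$ and run with random tape $\mathbf r$ halts with a memory tape satisfying $\beta$. In both cases satisfaction extends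 to all basic formulas by the usual Boolean clauses. A basic formula is *satisfiable* if some non-probabilistic simulation model satisfies it. For a probabilistic model $\mathsf T$ put $\mathbb P_{\mathsf T}(\varphi)=\mu(\{\mathbf r\in\{0,1\}^{\infty} : \mathsf T,\mathbf r\models\varphi\})$, where $\mu$ is the product of the $\mathrm{Bernoulli}(1/2)$ measures on $\{0,1\}^{\infty}$. **Lemma.** Let $\varphi_1,\dots,\varphi_n$ be satisfiable formulas of the basic language such that $\varphi_i\wedge\varphi_j$ is unsatisfiable whenever $i\neq j$, and let $p_1,\dots,p_n\ge 0$ be rational numbers with $p_1+\dots+p_n=1$. Then there is a probabilistic simulation model $\mathsf T$ such that $\mathbb P_{\mathsf T}(\varphi_i)=p_i$ for every $i$ with $1\le i\le n$. -/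

import Mathlib

namespace ProbSim

/-! ### Syntax of the basic language -/

/-- Propositional formulas over the tape variables; `atom i` says that square `i` holds `1`. -/
inductive PropForm : Type
  | atom (i : ℕ) : PropForm
  | neg (β : PropForm) : PropForm
  | conj (β γ : PropForm) : PropForm
  | disj (β γ : PropForm) : PropForm

/-- Truth of a propositional formula under an assignment of values to the tape squares. -/
def PropForm.Sat (v : ℕ → Bool) : PropForm → Prop
  | .atom i => v i = true
  | .neg β => ¬ β.Sat v
  | .conj β γ => β.Sat v ∧ γ.Sat v
  | .disj β γ => β.Sat v ∨ γ.Sat v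

/-- Intervention specifications: (possibly empty) conjunctions of literals with strictly
increasing indices. The pair `(i, true)` is the literal `X_i`, the pair `(i, false)` is `¬X_i`. -/
structure IntForm : Type where
  lits : List (ℕ × Bool)
  ordered : lits.Pairwise fun a b => a.1 < b.1

/-- The value to which square `i` is held by the intervention; `none` if `i` is not fixed. -/
def IntForm.held (α : IntForm) (i : ℕ) : Option Bool :=
  α.lits.lookup i

/-- The basic language: Boolean combinations of conditionals `⟨α⟩β`. -/
inductive Form : Type
  | cond (α : IntForm) (β : PropForm) : Form
  | neg (φ : Form) : Form
  | conj (φ ψ : Form) : Form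
  | disj (φ ψ : Form) : Form

/-- Satisfaction of a formula, given the truth values of the conditionals `⟨α⟩β`. -/
def Form.Eval (A : IntForm → PropForm → Prop) : Form → Prop
  | .cond α β => A α β
  | .neg φ => ¬ φ.Eval A
  | .conj φ ψ => φ.Eval A ∧ ψ.Eval A
  | .disj φ ψ => φ.Eval A ∨ ψ.Eval A

/-! ### Tapes: squares `0, 1, 2, …` holding bits -/

/-- Head moves. -/
inductive Move : Type
  | left
  | stay
  | right

/-- New head position; a left move on square `0` leaves the head there. -/
def Move.apply : Move → ℕ → ℕ
  | .left, i => i - 1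
  | .stay, i => i
  | .right, i => i + 1

/-- The empty tape (all zeros) after the values fixed by the intervention have been written. -/
def initMem (α : IntForm) : ℕ → Bool :=
  fun i => (α.held i).getD false

/-- Write `b` to square `i`, ignoring the write if the intervention holds square `i` fixed. -/
def writeMem (α : IntForm) (v : ℕ → Bool) (i : ℕ) (b : Bool) : ℕ → Bool :=
  match α.held i with
  | some _ => v
  | none => Function.update v i b

/-! ### Non-probabilistic simulation models -/

/-- A deterministic Turing machine with one binary tape. From the state and the bit under the
head, `δ` gives the new state, the bit to be written and the head move; `none` means halting. -/
structure SimModel : Type 1 where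
  Q : Type
  [finQ : Finite Q]
  start : Q
  δ : Q → Bool → Option (Q × Bool × Move)

/-- Configurations of a non-probabilistic simulation model. -/
structure SimModel.Cfg (T : SimModel) : Type where
  state : T.Q
  pos : ℕ
  mem : ℕ → Bool

/-- One step of the machine `T` under the intervention `α`. -/
def SimModel.step (T : SimModel) (α : IntForm) (c : T.Cfg) : Option T.Cfg :=
  (T.δ c.state (c.mem c.pos)).map fun (q, b, m) =>
    { state := q, pos := m.apply c.pos, mem := writeMem α c.mem c.pos b }

/-- The initial configuration of `T` under the intervention `α`. -/
def SimModel.init (T : SimModel) (α : IntForm) : T.Cfg :=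
  { state := T.start, pos := 0, mem := initMem α }

/-- `T ⊨ ⟨α⟩β`: under the intervention `α`, `T` halts with a tape satisfying `β`. -/
def SimModel.SatCond (T : SimModel) (α : IntForm) (β : PropForm) : Prop :=
  ∃ c ∈ StateTransition.eval (T.step α) (T.init α), β.Sat c.mem

/-- `T ⊨ φ` for a non-probabilistic simulation model. -/
def SimModel.Sat (T : SimModel) (φ : Form) : Prop :=
  φ.Eval T.SatCond

/-- A formula of the basic language is satisfiable if some non-probabilistic simulation model
satisfies it. -/
def Form.Satisfiable (φ : Form) : Prop :=
  ∃ T : SimModel, T.Sat φ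

/-! ### Probabilistic simulation models -/

/-- A probabilistic Turing machine: a deterministic Turing machine with one binary read-write
memory tape and read access to a random bit tape. From the state, the bit under the memory head
and the bit under the random-tape head, `δ` gives the new state, the bit to be written to the
memory tape, the move of the memory head and the move of the random-tape head; `none` means
halting. -/
structure ProbSimModel : Type 1 where
  Q : Type
  [finQ : Finite Q]
  start : Q
  δ : Q → Bool → Bool → Option (Q × Bool × Move × Move)

/-- Configurations of a probabilistic simulation model (the random tape never changes). -/
structure ProbSimModel.Cfg (T : ProbSimModel) : Type where
  state : T.Q
  pos : ℕ
  rpos : ℕ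
  mem : ℕ → Bool

/-- One step of `T` under the intervention `α`, with the random bit tape fixed to `r`. -/
def ProbSimModel.step (T : ProbSimModel) (r : ℕ → Bool) (α : IntForm) (c : T.Cfg) :
    Option T.Cfg :=
  (T.δ c.state (c.mem c.pos) (r c.rpos)).map fun (q, b, m, m') =>
    { state := q, pos := m.apply c.pos, rpos := m'.apply c.rpos,
      mem := writeMem α c.mem c.pos b }

/-- The initial configuration of `T` under the intervention `α`. -/
def ProbSimModel.init (T : ProbSimModel) (α : IntForm) : T.Cfg :=
  { state := T.start, pos := 0, rpos := 0, mem := initMem α }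

/-- `T, r ⊨ ⟨α⟩β`: under the intervention `α` and with random bit tape `r`, `T` halts with a
memory tape satisfying `β`. -/
def ProbSimModel.SatCond (T : ProbSimModel) (r : ℕ → Bool) (α : IntForm) (β : PropForm) : Prop :=
  ∃ c ∈ StateTransition.eval (T.step r α) (T.init α), β.Sat c.mem

/-- `T, r ⊨ φ`. -/
def ProbSimModel.Sat (T : ProbSimModel) (r : ℕ → Bool) (φ : Form) : Prop :=
  φ.Eval (T.SatCond r)

/-- The law of a sequence of independent fair coin flips on `{0,1}^∞`. -/
noncomputable def coinMeasure : MeasureTheory.Measure (ℕ → Bool) :=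
  MeasureTheory.Measure.infinitePi fun _ => (PMF.uniformOfFintype Bool).toMeasure

/-- The set `S(φ)` of random bit tapes `r` with `T, r ⊨ φ`. -/
def ProbSimModel.satSet (T : ProbSimModel) (φ : Form) : Set (ℕ → Bool) :=
  {r | T.Sat r φ}

/-- `P_T(φ)`, the probability that `T` satisfies `φ`. -/
noncomputable def ProbSimModel.prob (T : ProbSimModel) (φ : Form) : ℝ :=
  coinMeasure.real (T.satSet φ)

/-! ### The sets `S(φ)` are measurable, so that `P_T(φ)` is well defined -/

/-- Halting after exactly `n` steps in a configuration with property `P`. -/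
def HaltsIn {σ : Type*} (f : σ → Option σ) (P : σ → Prop) : ℕ → σ → Prop
  | 0, c => f c = none ∧ P c
  | n + 1, c => ∃ c', f c = some c' ∧ HaltsIn f P n c'

theorem exists_mem_eval_iff {σ : Type*} (f : σ → Option σ) (P : σ → Prop) (c : σ) :
    (∃ d ∈ StateTransition.eval f c, P d) ↔ ∃ n, HaltsIn f P n c := by
  constructor
  · rintro ⟨d, hd, hP⟩
    obtain ⟨hr, hn⟩ := StateTransition.mem_eval.1 hd
    induction hr using Relation.ReflTransGen.head_induction_on with
    | refl => exact ⟨0, hn, hP⟩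
    | head h _ ih =>
      obtain ⟨n, h'⟩ := ih (StateTransition.mem_eval.2 ⟨by assumption, hn⟩)
      exact ⟨n + 1, _, h, h'⟩
  · rintro ⟨n, hn⟩
    induction n generalizing c with
    | zero => exact ⟨c, StateTransition.mem_eval.2 ⟨.refl, hn.1⟩, hn.2⟩
    | succ n ih =>
      obtain ⟨c', h, h'⟩ := hn
      obtain ⟨d, hd, hP⟩ := ih c' h'
      obtain ⟨hr, hn⟩ := StateTransition.mem_eval.1 hd
      exact ⟨d, StateTransition.mem_eval.2 ⟨.head h hr, hn⟩, hP⟩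

theorem ProbSimModel.measurableSet_haltsIn (T : ProbSimModel) (α : IntForm) (P : T.Cfg → Prop)
    (n : ℕ) (c : T.Cfg) : MeasurableSet {r : ℕ → Bool | HaltsIn (T.step r α) P n c} := by
  have key : ∀ (k : ℕ) (R : Bool → Set (ℕ → Bool)), (∀ b, MeasurableSet (R b)) →
      MeasurableSet {r : ℕ → Bool | r ∈ R (r k)} := by
    intro k R hR
    have : {r : ℕ → Bool | r ∈ R (r k)} =
        ⋃ b, ((fun r : ℕ → Bool => r k) ⁻¹' {b}) ∩ R b := by
      ext r; simp
    rw [this]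
    exact MeasurableSet.iUnion fun b =>
      ((measurable_pi_apply k) (measurableSet_singleton b)).inter (hR b)
  induction n generalizing c with
  | zero =>
    exact key c.rpos (fun b => {_r | T.step (fun _ => b) α c = none ∧ P c}) fun b => .const _
  | succ n ih =>
    refine key c.rpos (fun b => {r | ∃ c', T.step (fun _ => b) α c = some c' ∧
      HaltsIn (T.step r α) P n c'}) fun b => ?_
    cases h : T.step (fun _ => b) α c with
    | none => simp
    | some d => simpa using ih d

theorem ProbSimModel.measurableSet_satSet (T : ProbSimModel) (φ : Form) :
    MeasurableSet (T.satSet φ) := by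
  induction φ with
  | cond α β =>
    have : T.satSet (.cond α β) =
        ⋃ n, {r | HaltsIn (T.step r α) (fun c => β.Sat c.mem) n (T.init α)} := by
      ext r
      simp only [Set.mem_iUnion, Set.mem_ofPred_eq]
      exact exists_mem_eval_iff _ (fun c : T.Cfg => β.Sat c.mem) _
    rw [this]
    exact MeasurableSet.iUnion fun n => T.measurableSet_haltsIn α _ n _
  | neg φ ih => exact ih.compl
  | conj φ ψ ih₁ ih₂ => exact ih₁.inter ih₂
  | disj φ ψ ih₁ ih₂ => exact ih₁.union ih₂

end ProbSim

/-! Choose `S i` satisfying `φ i` and write the `p i` over a common denominator `M + 1`. A table of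
`M + 1` labels with frequencies `p i` is a step function on [0,1), and fair bits pick a point of
[0,1) digit by digit. `halve` restricts the step function to the chosen dyadic half and rescales it;
the length stays `M + 1`, so finitely many states suffice. Once the table is constantly `i`, the
machine runs `S i`. The breaks of the table are shared out among the halves, so after `k` bits at
most `breaks f` of the `2 ^ k` outcomes are undecided. Hence label `i` is selected with probability
at least `p i` (`le_coinMeasure_real_exists_selects`). Selection ignores the intervention, so the
mixture then satisfies the same formulas as `S i` (`Selects.mixture_sat_iff`). Exclusivity of the `φ
i` and `∑ p i = 1` turn these lower bounds into equalities. -/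

namespace ProbSim

open MeasureTheory

/-! ### Halving label tables -/

section LabelTable

variable {ι : Type} {M : ℕ}

/-- The entry of a label table at the index `k` modulo its length. -/
def entry (f : Fin (M + 1) → ι) (k : ℕ) : ι := f (Fin.ofNat (M + 1) k)

/-- Repeat every entry of a label table twice and keep the half selected by the bit `b`. -/
def halve (f : Fin (M + 1) → ι) (b : Bool) : Fin (M + 1) → ι :=
  fun j => entry f ((bif b then M + 1 + j else (j : ℕ)) / 2)

open Classical in
/-- The number of entries of a label table that carry the label `i`. -/
noncomputable def labelCount (f : Fin (M + 1) → ι) (i : ι) : ℕ :=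
  ∑ k ∈ Finset.range (M + 1), if entry f k = i then 1 else 0

open Classical in
/-- The number of pairs of adjacent entries of a label table that differ. -/
noncomputable def breaks (f : Fin (M + 1) → ι) : ℕ :=
  ∑ k ∈ Finset.range M, if entry f k = entry f (k + 1) then 0 else 1

theorem entry_val (f : Fin (M + 1) → ι) (j : Fin (M + 1)) : entry f j = f j := by
  simp [entry]

theorem entry_halve_false (f : Fin (M + 1) → ι) {k : ℕ} (hk : k < M + 1) :
    entry (halve f false) k = entry f (k / 2) := by
  simp [entry, halve, Nat.mod_eq_of_lt hk]

theorem entry_halve_true (f : Fin (M + 1) → ι) {k : ℕ} (hk : k < M + 1) :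
    entry (halve f true) k = entry f ((M + 1 + k) / 2) := by
  simp [entry, halve, Nat.mod_eq_of_lt hk]

theorem sum_range_two_mul_div_two (g : ℕ → ℕ) (N : ℕ) :
    ∑ k ∈ Finset.range (2 * N), g (k / 2) = 2 * ∑ k ∈ Finset.range N, g k := by
  induction N with
  | zero => simp
  | succ N ih =>
    rw [show 2 * (N + 1) = 2 * N + 1 + 1 by ring, Finset.sum_range_succ, Finset.sum_range_succ,
      ih, Finset.sum_range_succ, show (2 * N + 1) / 2 = N by omega, show 2 * N / 2 = N by omega]
    ring

theorem labelCount_halve (f : Fin (M + 1) → ι) (i : ι) :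
    labelCount (halve f false) i + labelCount (halve f true) i = 2 * labelCount f i := by
  classical
  unfold labelCount
  rw [← sum_range_two_mul_div_two (fun k => if entry f k = i then 1 else 0), two_mul (M + 1),
    Finset.sum_range_add _ (M + 1) (M + 1)]
  congr 1
  · refine Finset.sum_congr rfl fun k hk => ?_
    rw [entry_halve_false f (Finset.mem_range.1 hk)]
  · refine Finset.sum_congr rfl fun k hk => ?_
    rw [entry_halve_true f (Finset.mem_range.1 hk)]

theorem sum_range_breaks_doubled (g : ℕ → ι) [DecidableEq ι] (M : ℕ) :
    ∑ k ∈ Finset.range (2 * M + 1), (if g (k / 2) = g ((k + 1) / 2) then 0 else 1) =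
      ∑ k ∈ Finset.range M, if g k = g (k + 1) then 0 else 1 := by
  induction M with
  | zero => simp
  | succ M ih =>
    rw [show 2 * (M + 1) + 1 = 2 * M + 1 + 1 + 1 by ring, Finset.sum_range_succ,
      Finset.sum_range_succ, ih, Finset.sum_range_succ, show (2 * M + 1) / 2 = M by omega,
      show (2 * M + 1 + 1) / 2 = M + 1 by omega, show (2 * M + 1 + 1 + 1) / 2 = M + 1 by omega]
    simp

/-- Doubling every entry creates no new break; cutting in the middle can only lose one, hence the
inequality. -/
theorem breaks_halve_le (f : Fin (M + 1) → ι) :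
    breaks (halve f false) + breaks (halve f true) ≤ breaks f := by
  classical
  unfold breaks
  rw [← sum_range_breaks_doubled (entry f), show 2 * M + 1 = M + 1 + M by ring,
    Finset.sum_range_add _ (M + 1) M]
  refine add_le_add ?_ (le_of_eq ?_)
  -- The term `k = M` compares the two entries on either side of the cut; it is dropped.
  · rw [Finset.sum_range_succ]
    refine le_trans (le_of_eq ?_) (Nat.le_add_right _ _)
    refine Finset.sum_congr rfl fun k hk => ?_
    have hk := Finset.mem_range.1 hk
    rw [entry_halve_false f (by omega), entry_halve_false f (by omega)]
  · refine Finset.sum_congr rfl fun k hk => ?_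
    have hk := Finset.mem_range.1 hk
    rw [entry_halve_true f (by omega), entry_halve_true f (by omega), add_assoc (M + 1) k 1]

theorem eq_const_of_breaks_eq_zero (f : Fin (M + 1) → ι) (h : breaks f = 0) :
    ∀ j, f j = entry f 0 := by
  classical
  have hstep : ∀ k < M, entry f k = entry f (k + 1) := by
    intro k hk
    have := Finset.sum_eq_zero_iff.1 h k (Finset.mem_range.2 hk)
    by_contra hne
    simp [hne] at this
  have hall : ∀ k ≤ M, entry f k = entry f 0 := by
    intro k
    induction k with
    | zero => simp
    | succ k ih => exact fun hk => (hstep k hk).symm.trans (ih (by omega))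
  intro j
  rw [← entry_val f j]
  exact hall j (by omega)

theorem labelCount_le (f : Fin (M + 1) → ι) (i : ι) : labelCount f i ≤ M + 1 := by
  classical
  refine (Finset.sum_le_card_nsmul _ _ 1 fun k _ => ?_).trans (by simp)
  split_ifs <;> simp

theorem labelCount_eq_card [DecidableEq ι] (f : Fin (M + 1) → ι) (i : ι) :
    labelCount f i = Fintype.card {j // f j = i} := by
  classical
  unfold labelCount
  rw [Finset.sum_range, Fintype.card_subtype, Finset.card_filter]
  exact Finset.sum_congr rfl fun j _ => by simp only [entry_val]

/-- Halving the table `f` successively by the bits `r m, …, r (m + k - 1)` leaves the table with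
all labels equal to `i`. -/
def Selects (r : ℕ → Bool) (i : ι) : ℕ → (Fin (M + 1) → ι) → ℕ → Prop
  | 0, f, _ => ∀ j, f j = i
  | k + 1, f, m => Selects r i k (halve f (r m)) (m + 1)

/-- Halving preserves constant tables. This matters because the machine stops reading bits at the
first constant table, possibly before `k` bits. -/
theorem Selects.eq_of_const {r : ℕ → Bool} {i i' : ι} {k : ℕ} {f : Fin (M + 1) → ι} {m : ℕ}
    (h : Selects r i k f m) (hf : ∀ j, f j = i') : i' = i := by
  induction k generalizing f m with
  | zero => exact (hf 0).symm.trans (h 0)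
  | succ k ih => exact ih (f := halve f (r m)) h fun j => hf _

theorem setOf_selects_succ (i : ι) (k : ℕ) (f : Fin (M + 1) → ι) (m : ℕ) :
    {r | Selects r i (k + 1) f m} =
      ⋃ b, {r : ℕ → Bool | r m = b} ∩ {r | Selects r i k (halve f b) (m + 1)} := by
  ext r
  simp [Selects]

theorem measurableSet_selects (i : ι) (k : ℕ) (f : Fin (M + 1) → ι) (m : ℕ) :
    MeasurableSet {r | Selects r i k f m} := by
  induction k generalizing f m with
  | zero => exact .const _
  | succ k ih =>
    rw [setOf_selects_succ]
    refine .iUnion fun b => .inter ?_ (ih _ _)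
    exact measurableSet_eq_fun (measurable_pi_apply m) measurable_const

end LabelTable

/-! ### Selection probabilities -/

instance : IsProbabilityMeasure coinMeasure := by
  unfold coinMeasure
  infer_instance

/-- The bit sequences that agree with `w` before position `m`. -/
def cyl (w : ℕ → Bool) (m : ℕ) : Set (ℕ → Bool) := {r | ∀ j < m, r j = w j}

theorem cyl_eq_pi (w : ℕ → Bool) (m : ℕ) :
    cyl w m = Set.pi (Finset.range m) fun j => {w j} := by
  ext r
  simp [cyl, Set.mem_pi]

theorem measurableSet_cyl (w : ℕ → Bool) (m : ℕ) : MeasurableSet (cyl w m) := by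
  rw [cyl_eq_pi]
  exact .pi (Finset.countable_toSet _) fun j _ => measurableSet_singleton _

theorem coinMeasure_real_cyl (w : ℕ → Bool) (m : ℕ) : coinMeasure.real (cyl w m) = (1 / 2) ^ m := by
  rw [cyl_eq_pi, Measure.real, coinMeasure,
    Measure.infinitePi_pi _ fun j _ => measurableSet_singleton _]
  simp

theorem mem_cyl_update_succ {w r : ℕ → Bool} {m : ℕ} {b : Bool} :
    r ∈ cyl (Function.update w m b) (m + 1) ↔ r ∈ cyl w m ∧ r m = b := by
  constructor
  · intro h
    refine ⟨fun j hj => ?_, by simpa using h m (Nat.lt_succ_self m)⟩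
    simpa [Function.update_of_ne hj.ne] using h j (hj.trans (Nat.lt_succ_self m))
  · rintro ⟨h, hm⟩ j hj
    rcases Nat.lt_succ_iff_lt_or_eq.1 hj with hj | rfl
    · rw [Function.update_of_ne hj.ne]
      exact h j hj
    · simpa using hm

theorem coinMeasure_real_selects_succ {ι : Type} {M : ℕ} (i : ι) (k : ℕ) (f : Fin (M + 1) → ι)
    (m : ℕ) (w : ℕ → Bool) :
    coinMeasure.real (cyl w m ∩ {r | Selects r i (k + 1) f m}) =
      coinMeasure.real (cyl (Function.update w m false) (m + 1) ∩
        {r | Selects r i k (halve f false) (m + 1)}) +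
      coinMeasure.real (cyl (Function.update w m true) (m + 1) ∩
        {r | Selects r i k (halve f true) (m + 1)}) := by
  rw [← measureReal_union]
  · congr 1
    ext r
    cases h : r m <;> simp [mem_cyl_update_succ, Selects, h]
  · refine Set.disjoint_left.2 fun r h h' => ?_
    have h₁ := (mem_cyl_update_succ.1 h.1).2
    have h₂ := (mem_cyl_update_succ.1 h'.1).2
    simp [h₁] at h₂
  · exact (measurableSet_cyl _ _).inter (measurableSet_selects _ _ _ _)

/-- Conditioning on one bit averages the bounds for the two halves: label frequencies average
exactly, and the total number of breaks does not grow. -/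
theorem le_coinMeasure_real_selects {ι : Type} {M : ℕ} (i : ι) (k : ℕ) (f : Fin (M + 1) → ι)
    (m : ℕ) (w : ℕ → Bool) :
    (1 / 2) ^ m * ((labelCount f i : ℝ) / (M + 1 : ℕ) - (1 / 2) ^ k * breaks f) ≤
      coinMeasure.real (cyl w m ∩ {r | Selects r i k f m}) := by
  classical
  induction k generalizing f m w with
  | zero =>
    have hle : (labelCount f i : ℝ) / (M + 1 : ℕ) ≤ 1 := by
      rw [div_le_one (by positivity)]
      exact_mod_cast labelCount_le f i
    by_cases hi : ∀ j, f j = i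
    · have : {r : ℕ → Bool | Selects r i 0 f m} = Set.univ := Set.eq_univ_of_forall fun r => hi
      rw [this, Set.inter_univ, coinMeasure_real_cyl]
      refine mul_le_of_le_one_right (by positivity) ?_
      have : (0 : ℝ) ≤ (1 / 2) ^ 0 * breaks f := by positivity
      linarith
    -- Here the lower bound is at most 0: either the table is constant with another label, or its
    -- breaks number at least 1 and outweigh the frequency.
    · refine le_trans ?_ measureReal_nonneg
      refine mul_nonpos_of_nonneg_of_nonpos (by positivity) ?_
      rcases Nat.eq_zero_or_pos (breaks f) with h0 | hpos
      · have hc := eq_const_of_breaks_eq_zero f h0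
        have hne : entry f 0 ≠ i := fun h => hi fun j => (hc j).trans h
        have : labelCount f i = 0 := Finset.sum_eq_zero fun k _ => by
          rw [if_neg]
          exact fun h => hne ((hc _).symm.trans h)
        simp [this, h0]
      · have : (1 : ℝ) ≤ breaks f := by exact_mod_cast hpos
        linarith
  | succ k ih =>
    rw [coinMeasure_real_selects_succ]
    refine le_trans ?_ (add_le_add (ih _ _ _) (ih _ _ _))
    have hc : (labelCount (halve f false) i : ℝ) + labelCount (halve f true) i =
        2 * labelCount f i := by exact_mod_cast labelCount_halve f i
    have hb : (breaks (halve f false) : ℝ) + breaks (halve f true) ≤ breaks f := by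
      exact_mod_cast breaks_halve_le f
    rw [← mul_add, pow_succ _ m, mul_assoc]
    refine mul_le_mul_of_nonneg_left ?_ (by positivity)
    have hb' := mul_le_mul_of_nonneg_left hb (by positivity : (0 : ℝ) ≤ (1 / 2) ^ k)
    have hc' : (labelCount (halve f false) i : ℝ) / (M + 1 : ℕ) +
        labelCount (halve f true) i / (M + 1 : ℕ) = 2 * (labelCount f i / (M + 1 : ℕ)) := by
      rw [← add_div, hc, mul_div_assoc]
    rw [pow_succ]
    linarith

theorem le_coinMeasure_real_exists_selects {ι : Type} {M : ℕ} (i : ι) (f : Fin (M + 1) → ι) :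
    (labelCount f i : ℝ) / (M + 1 : ℕ) ≤ coinMeasure.real {r | ∃ k, Selects r i k f 0} := by
  have hbound : ∀ k : ℕ, (labelCount f i : ℝ) / (M + 1 : ℕ) - (1 / 2) ^ k * breaks f ≤
      coinMeasure.real {r | ∃ k, Selects r i k f 0} := by
    intro k
    have h := le_coinMeasure_real_selects i k f 0 fun _ => false
    rw [pow_zero, one_mul] at h
    exact h.trans (measureReal_mono fun r hr => ⟨k, hr.2⟩)
  have hlim : Filter.Tendsto
      (fun k : ℕ => (labelCount f i : ℝ) / (M + 1 : ℕ) - (1 / 2) ^ k * breaks f)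
      Filter.atTop (nhds ((labelCount f i : ℝ) / (M + 1 : ℕ) - 0 * breaks f)) :=
    ((tendsto_pow_atTop_nhds_zero_of_lt_one (by norm_num) (by norm_num)).mul_const _).const_sub _
  simpa using le_of_tendsto' hlim hbound

/-! ### The machine that selects a model at random and then runs it -/

section Mixture

variable {ι : Type} [Finite ι] {M : ℕ}

open Classical in
/-- The machine that halves the label table `f` by the random bits until all labels are equal to
some `i`, leaving its memory untouched, and then runs the model `S i`. -/
noncomputable def mixture (S : ι → SimModel) (f : Fin (M + 1) → ι) : ProbSimModel where
  Q := (Fin (M + 1) → ι) ⊕ Σ i, (S i).Q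
  finQ := by
    have := fun i => (S i).finQ
    infer_instance
  start := .inl f
  δ
    | .inl g, b, x =>
      if h : ∃ i, ∀ j, g j = i then
        some (.inr ⟨h.choose, (S h.choose).start⟩, b, .stay, .stay)
      else some (.inl (halve g x), b, .stay, .right)
    | .inr ⟨i, q⟩, b, _ =>
      ((S i).δ q b).map fun (q', b', m) => (.inr ⟨i, q'⟩, b', m, .stay)

/-- Writing back the bit just read is harmless on held and free squares alike, so the selection
phase leaves the memory intact. -/
theorem writeMem_self (α : IntForm) (v : ℕ → Bool) (i : ℕ) : writeMem α v i (v i) = v := by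
  unfold writeMem
  split <;> simp

/-- The configuration of the mixture that corresponds to a configuration of the model `S i`. -/
def mixtureCfg (S : ι → SimModel) (f : Fin (M + 1) → ι) (m : ℕ) {i : ι} (c : (S i).Cfg) :
    (mixture S f).Cfg :=
  ⟨.inr ⟨i, c.state⟩, c.pos, m, c.mem⟩

theorem mixture_step_mixtureCfg (S : ι → SimModel) (f : Fin (M + 1) → ι) (r : ℕ → Bool)
    (α : IntForm) (m : ℕ) {i : ι} (c : (S i).Cfg) :
    (mixture S f).step r α (mixtureCfg S f m c) =
      ((S i).step α c).map (mixtureCfg S f m) := by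
  refine (Option.map_map _ _ _).trans ?_
  rw [SimModel.step, Option.map_map]
  rfl

theorem haltsIn_mixtureCfg (S : ι → SimModel) (f : Fin (M + 1) → ι) (r : ℕ → Bool)
    (α : IntForm) (β : PropForm) (m : ℕ) {i : ι} (n : ℕ) (c : (S i).Cfg) :
    HaltsIn ((mixture S f).step r α) (fun d => β.Sat d.mem) n (mixtureCfg S f m c) ↔
      HaltsIn ((S i).step α) (fun d => β.Sat d.mem) n c := by
  induction n generalizing c with
  | zero =>
    simp only [HaltsIn, mixture_step_mixtureCfg, Option.map_eq_none_iff]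
    rfl
  | succ n ih =>
    cases h : (S i).step α c <;> simp [HaltsIn, mixture_step_mixtureCfg, h, ih]

theorem Selects.exists_reaches {S : ι → SimModel} {f : Fin (M + 1) → ι} {r : ℕ → Bool} {i : ι}
    {k : ℕ} {g : Fin (M + 1) → ι} {m : ℕ} (h : Selects r i k g m) (α : IntForm) :
    ∃ m', StateTransition.Reaches ((mixture S f).step r α) ⟨.inl g, 0, m, initMem α⟩
      (mixtureCfg S f m' ((S i).init α)) := by
  induction k generalizing g m with
  | zero =>
    refine ⟨m, .single ?_⟩
    have hex : ∃ i, ∀ j, g j = i := ⟨i, h⟩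
    have hi : hex.choose = i := (hex.choose_spec 0).symm.trans (h 0)
    simp only [ProbSimModel.step, mixture, dif_pos hex, Option.map_some,
      writeMem_self, Move.apply, mixtureCfg, SimModel.init]
    rw [hi]
    rfl
  | succ k ih =>
    by_cases hex : ∃ i, ∀ j, g j = i
    · have hi : hex.choose = i := h.eq_of_const (k := k + 1) hex.choose_spec
      refine ⟨m, .single ?_⟩
      simp only [ProbSimModel.step, mixture, dif_pos hex, Option.map_some,
        writeMem_self, Move.apply, mixtureCfg, SimModel.init]
      rw [hi]
      rfl
    · obtain ⟨m', hm'⟩ := ih (g := halve g (r m)) h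
      refine ⟨m', .head ?_ hm'⟩
      simp only [ProbSimModel.step, mixture, dif_neg hex, Option.map_some,
        writeMem_self, Move.apply]
      rfl

theorem Selects.mixture_sat_iff {S : ι → SimModel} {f : Fin (M + 1) → ι} {r : ℕ → Bool} {i : ι}
    {k : ℕ} (h : Selects r i k f 0) (ψ : Form) : (mixture S f).Sat r ψ ↔ (S i).Sat ψ := by
  -- The label `i` depends on `r` alone, so all conditionals agree at once, whatever their `α`, and
  -- with them all Boolean combinations.
  have hcond : (mixture S f).SatCond r = (S i).SatCond := by
    funext α β
    obtain ⟨m, hm⟩ := h.exists_reaches (S := S) (f := f) α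
    have hinit : (mixture S f).init α = ⟨.inl f, 0, 0, initMem α⟩ := rfl
    refine propext ?_
    unfold ProbSimModel.SatCond SimModel.SatCond
    rw [hinit, StateTransition.reaches_eval hm]
    exact ((exists_mem_eval_iff _ (fun d : (mixture S f).Cfg => β.Sat d.mem) _).trans
      (exists_congr fun n => haltsIn_mixtureCfg S f r α β m n _)).trans
      (exists_mem_eval_iff _ (fun d : (S i).Cfg => β.Sat d.mem) _).symm
  unfold ProbSimModel.Sat SimModel.Sat
  rw [hcond]

end Mixture

/-! ### Label tables with prescribed frequencies -/

theorem exists_labelCount_div_eq {ι : Type} [Fintype ι] (p : ι → ℚ) (hp : ∀ i, 0 ≤ p i)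
    (hsum : ∑ i, p i = 1) :
    ∃ (M : ℕ) (f : Fin (M + 1) → ι), ∀ i, (labelCount f i : ℝ) / (M + 1 : ℕ) = p i := by
  classical
  set N := ∏ i, (p i).den with hN
  have hNpos : 0 < N := Finset.prod_pos fun i _ => (p i).den_pos
  have hint : ∀ i, ∃ a : ℕ, (a : ℚ) = p i * N := by
    intro i
    obtain ⟨d, hd⟩ : (p i).den ∣ N := Finset.dvd_prod_of_mem _ (Finset.mem_univ i)
    refine ⟨(p i).num.toNat * d, ?_⟩
    have hnum : (((p i).num.toNat : ℕ) : ℚ) = (p i).num := by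
      exact_mod_cast Int.toNat_of_nonneg (Rat.num_nonneg.2 (hp i))
    rw [hd, Nat.cast_mul, Nat.cast_mul, hnum, ← mul_assoc, Rat.mul_den_eq_num]
  choose a ha using hint
  have hasum : ∑ i, a i = N := by
    have : ((∑ i, a i : ℕ) : ℚ) = N := by
      rw [Nat.cast_sum, Finset.sum_congr rfl fun i _ => ha i, ← Finset.sum_mul, hsum, one_mul]
    exact_mod_cast this
  obtain ⟨M, hM⟩ : ∃ M, N = M + 1 := ⟨N - 1, by omega⟩
  -- Any arrangement of the labels will do: only their frequencies survive in the limit.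
  have e : Fin (M + 1) ≃ Σ i, Fin (a i) :=
    Fintype.equivOfCardEq (by simp [hasum, hM])
  refine ⟨M, fun j => (e j).1, fun i => ?_⟩
  have hcard : labelCount (fun j => (e j).1) i = a i := by
    rw [labelCount_eq_card, Fintype.card_congr ((e.subtypeEquiv fun _ => Iff.rfl).trans
      (Equiv.sigmaSubtype (α := ι) (β := fun i => Fin (a i)) i)), Fintype.card_fin]
  rw [hcard, div_eq_iff (by positivity), ← hM]
  exact_mod_cast ha i

end ProbSim

theorem mainTheorem6 (n : ℕ) (φ : Fin n → ProbSim.Form)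
    (hsat : ∀ i, (φ i).Satisfiable)
    (hdisj : ∀ i j, i ≠ j → ¬ ((φ i).conj (φ j)).Satisfiable)
    (p : Fin n → ℚ) (hp : ∀ i, 0 ≤ p i) (hsum : ∑ i, p i = 1) :
    ∃ T : ProbSim.ProbSimModel, ∀ i, T.prob (φ i) = (p i : ℝ) := by
  classical
  choose S hS using hsat
  obtain ⟨M, f, hf⟩ := ProbSim.exists_labelCount_div_eq p hp hsum
  refine ⟨ProbSim.mixture S f, fun i => ?_⟩
  set T := ProbSim.mixture S f
  let A : Fin n → Set (ℕ → Bool) := fun j => {r | ∃ k, ProbSim.Selects r j k f 0}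
  have hAsat : ∀ j, A j ⊆ T.satSet (φ j) := fun j r ⟨k, hk⟩ => (hk.mixture_sat_iff _).2 (hS j)
  have hAdisj : ∀ j l, j ≠ l → Disjoint (T.satSet (φ j)) (A l) := by
    refine fun j l hjl => Set.disjoint_left.2 fun r hr ⟨k, hk⟩ => hdisj j l hjl ⟨S l, ?_⟩
    exact ⟨(hk.mixture_sat_iff _).1 hr, hS l⟩
  have hAmeas : ∀ j, MeasurableSet (A j) := by
    intro j
    have : A j = ⋃ k, {r | ProbSim.Selects r j k f 0} := by
      ext r
      simp [A]
    rw [this]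
    exact .iUnion fun k => ProbSim.measurableSet_selects j k f 0
  have hAle : ∀ j, (p j : ℝ) ≤ ProbSim.coinMeasure.real (A j) := fun j =>
    (hf j).symm.le.trans (ProbSim.le_coinMeasure_real_exists_selects j f)
  -- The upper bound comes from the other labels: the set for `φ i` misses every `A j` with `j ≠ i`,
  -- and these have total measure at least `1 - p i`. Undecided sequences need no separate
  -- treatment.
  refine le_antisymm ?_ ((hAle i).trans (MeasureTheory.measureReal_mono (hAsat i)))
  have hunion : ProbSim.coinMeasure.real (⋃ j ∈ Finset.univ.erase i, A j) =
      ∑ j ∈ Finset.univ.erase i, ProbSim.coinMeasure.real (A j) :=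
    MeasureTheory.measureReal_biUnion_finset
      (fun j _ l _ hjl => (hAdisj j l hjl).mono_left (hAsat j)) fun j _ => hAmeas j
  have hle : T.prob (φ i) + ∑ j ∈ Finset.univ.erase i, ProbSim.coinMeasure.real (A j) ≤ 1 := by
    rw [← hunion, ProbSim.ProbSimModel.prob, ← MeasureTheory.measureReal_union
      (h₂ := MeasureTheory.measure_ne_top _ _)]
    · exact MeasureTheory.measureReal_le_one
    · simp only [Set.disjoint_iUnion_right]
      exact fun j hj => hAdisj i j (Finset.ne_of_mem_erase hj).symm
    · exact Finset.measurableSet_biUnion _ fun j _ => hAmeas j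
  have hrest := Finset.sum_le_sum fun j (_ : j ∈ Finset.univ.erase i) => hAle j
  have hsum' : (p i : ℝ) + ∑ j ∈ Finset.univ.erase i, (p j : ℝ) = 1 := by
    rw [Finset.add_sum_erase _ (fun j => (p j : ℝ)) (Finset.mem_univ i)]
    exact_mod_cast hsum
  linarith
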